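/- Let $\Omega=(-1,1)$ and let $H^2(\Omega)$ be the second-order Sobolev space of real functions on $\Omega$ (continuously differentiable $u$ with $u'$ absolutely continuous and $u''\in L^2(\Omega)$). Let $0<p<1$, $q=1-p$ and $B>0$. There is a constant $C_l>0$, depending only on $p$ and $B$, such that for every $\delta\in(0,1)$ there is an $n_0$ (depending only on $p,B,\delta$) such that the following holds for all $N>n_0$. Let $f:\mathbb R\to\mathbb R$ be $\nu$-Lipschitz and twice differentiable with $|f''|\le\eta$ for some $\eta>0$. Let $K\ge 1$, let $x_1,\dots,x_K\in\mathbb R$ be the data, let $\alpha_1<\dots<\alpha_K$ be points of $\Omega$ (encoder points), and let $u_{\rm enc}\in H^2(\Omega)$ be the encoder (any element of $H^2(\Omega)$, for instance a smoothing spline fitted to the data $(\alpha_k,x_k)$). Let $\beta_1<\dots<\beta_N$ be points of $\Omega$ (decoder points), put $\beta_0=-1$, $\beta_{N+1}=1$, and assume $\Delta_{\max}/\Delta_{\min}\le B$, where $\Delta_{\max}=\max_{0\le n\le N}(\beta_{n+1}-\beta_n)$ and $\Delta_{\min}=\min_{1\le n\le N-1}(\beta_{n+1}-\beta_n)$. Let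 $0\le\lambda_{\rm dec}\le N^{-4}$. For each nonempty set $\mathcal F\subseteq\{1,\dots,N\}$ of non-straggling servers let the decoder $u_{\rm dec}=u_{\rm dec}^{\mathcal F}$ be a minimizer over $u\in H^2(\Omega)$ of $$\frac1{|\mathcal F|}\sum_{v\in\mathcal F}\bigl(u(\beta_v)-f(u_{\rm enc}(\beta_v))\bigr)^2+\lambda_{\rm dec}\int_\Omega (u''(t))^2\,dt ,$$ where for $\lambda_{\rm dec}=0$ a minimizer of least $\int_\Omega (u'')^2$ is taken (the natural interpolating spline). Suppose that each server is a straggler with probability $p$, independently of the others, and let $\mathcal F$ be the random set of non-stragglers. Then with probability at least $1-\delta$ (over $\mathcal F$) the average approximation error $\mathcal L(\hat f)=\frac1K\sum_{k=1}^K\bigl(u_{\rm dec}(\alpha_k)-f(x_k)\bigr)^2$ satisfies $$\mathcal L(\hat f)\le C_l\,\frac{\bigl(\log_{1/p}(qN)+\sqrt{1/\delta}\bigr)^3}{N^3}\,\bigl\|(f\circ u_{\rm enc})''\bigr\|_{L^2(\Omega)}^2+\frac2K\sum_{k=1}^K\bigl(f(u_{\rm enc}(\alpha_k))-f(x_k)\bigr)^2$$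 and $$\mathcal L(\hat f)\le C_l\,\frac{\bigl(\log_{1/p}(qN)+\sqrt{1/\delta}\bigr)^3}{N^3}\,\bigl\|(f\circ u_{\rm enc})''\bigr\|_{L^2(\Omega)}^2+\frac{2\nu^2}K\sum_{k=1}^K\bigl(u_{\rm enc}(\alpha_k)-x_k\bigr)^2 .$$ -/

import Mathlib

open MeasureTheory ProbabilityTheory

noncomputable section

namespace LeTCC

/-- The open interval `Ω = (-1, 1)` in which all mapping points lie. -/
abbrev domain : Set ℝ := Set.Ioo (-1) 1

/-- `u` belongs to the second-order Sobolev space `H²(Ω)` of scalar functions (taken in its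
pointwise defined, continuously differentiable version): `u` is differentiable on `Ω`, `u'` is
absolutely continuous on every compact subinterval of `Ω`, and `u'' ∈ L²(Ω)`.
On the bounded interval `Ω` this already gives `u, u' ∈ L²(Ω)`. Only the values of `u` on the open
set `Ω` matter. -/
structure MemH2 (u : ℝ → ℝ) : Prop where
  differentiableOn : DifferentiableOn ℝ u domain
  absolutelyContinuous_deriv : ∀ a ∈ domain, ∀ b ∈ domain,
    AbsolutelyContinuousOnInterval (deriv u) a b
  memLp_deriv_deriv : MemLp (deriv (deriv u)) 2 (volume.restrict domain)

/-- `‖u''‖²` in `L²(Ω)`, that is, `∫_Ω (u''(t))² dt`. -/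
def roughness (u : ℝ → ℝ) : ℝ := ∫ t in domain, (deriv (deriv u) t) ^ 2

/-- The penalised least squares functional
`(1/|F|) ∑_{v ∈ F} (u(t_v) - y_v)² + lam ∫_Ω (u'')²`. -/
def splineLoss {N : ℕ} (F : Finset (Fin N)) (t y : Fin N → ℝ) (lam : ℝ) (u : ℝ → ℝ) : ℝ :=
  (1 / (F.card : ℝ)) * ∑ v ∈ F, (u (t v) - y v) ^ 2 + lam * roughness u

/-- `u` is a second-order smoothing spline for the data `(t_v, y_v)`, `v ∈ F`, with smoothing
parameter `lam`: it minimises the penalised least squares functional over `H²(Ω)`.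
For `lam = 0` (the non-smooth version) the minimisers are all the interpolants of the data, and
the smoothing spline is one of least `∫_Ω (u'')²` among them, the natural interpolating spline. -/
structure IsSmoothingSpline {N : ℕ} (F : Finset (Fin N)) (t y : Fin N → ℝ) (lam : ℝ)
    (u : ℝ → ℝ) : Prop where
  memH2 : MemH2 u
  isMin : ∀ w : ℝ → ℝ, MemH2 w → splineLoss F t y lam u ≤ splineLoss F t y lam w
  isMin_roughness : lam = 0 → ∀ w : ℝ → ℝ, MemH2 w →
    splineLoss F t y lam w = splineLoss F t y lam u → roughness u ≤ roughness w

/-- The decoder mapping points together with the end points of `Ω`: with the points numbered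
`β_1, …, β_N`, this is `β_0 = -1`, `β_n` for `1 ≤ n ≤ N`, and `β_{N+1} = 1`. -/
def node {N : ℕ} (β : Fin N → ℝ) : ℕ → ℝ
  | 0 => -1
  | n + 1 => if h : n < N then β ⟨n, h⟩ else 1

/-- `Δ_max = max_{0 ≤ n ≤ N} (β_{n+1} - β_n)`. -/
def gapMax {N : ℕ} (β : Fin N → ℝ) : ℝ :=
  ⨆ n : Fin (N + 1), (node β (n + 1) - node β n)

/-- `Δ_min = min_{1 ≤ n ≤ N-1} (β_{n+1} - β_n)`. -/
def gapMin {N : ℕ} (β : Fin N → ℝ) : ℝ :=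
  ⨅ n : Fin (N - 1), (node β (n + 2) - node β (n + 1))

open Classical in
/-- The set of non-stragglers in the outcome `s`, where `straggler n` is the event that server `n`
is a straggler. -/
def nonStragglers {S : Type*} {N : ℕ} (straggler : Fin N → Set S) (s : S) : Finset (Fin N) :=
  Finset.univ.filter fun n => s ∉ straggler n

/-- The average approximation error `(1/K) ∑_k (u_dec(α_k) - f(x_k))²` of a decoder `udec`. -/
def avgError {K : ℕ} (f : ℝ → ℝ) (α x : Fin K → ℝ) (udec : ℝ → ℝ) : ℝ :=
  (1 / (K : ℝ)) * ∑ k, (udec (α k) - f (x k)) ^ 2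

end LeTCC

end

/-!
Put `h = f ∘ u_enc`, `R = ∫ (h'')²` and `e = u_dec - h`. Comparing `u_dec` with the competitor `h`,
whose data term vanishes, gives `∫ (u_dec'')² ≤ R` and `e² ≤ N λ R` at every surviving node, so
`∫ (e'')² ≤ 4 R` and `e'` is Hölder continuous of exponent `1/2`. A union bound over the windows of
`m` consecutive servers shows that, with probability at least `1 - N p ^ m`, every interval of
length `L = m Δ_max` inside `Ω` contains a surviving node. Each `s ∈ Ω` then has two surviving nodes
at mutual distance between `L` and `3 L`, one of them within `L` of `s`, and extrapolating `e`
linearly through them yields `e(s)² ≲ N λ R + L³ R`. Finally `m ≍ log_{1/p} (q N) + √(1/δ)` makes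
`N p ^ m ≤ δ`, and `Δ_max ≤ B Δ_min ≤ 4 B / N`.
-/

open Set Filter Topology

namespace LeTCC

lemma sq_integral_le_measureReal_mul_integral_sq {S : Type*} [MeasurableSpace S] {μ : Measure S}
    [IsFiniteMeasure μ] {g : S → ℝ} (hg : MemLp g 2 μ) :
    (∫ t, g t ∂μ) ^ 2 ≤ μ.real univ * ∫ t, g t ^ 2 ∂μ := by
  rcases eq_zero_or_neZero μ with rfl | _
  · simp
  have hjensen := (even_two.convexOn_pow (𝕜 := ℝ)).map_average_le (by fun_prop) isClosed_univ
    (ae_of_all _ fun _ => mem_univ _) (hg.integrable one_le_two) hg.integrable_sq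
  have hμ : 0 < μ.real univ := measureReal_univ_pos
  rw [average_eq, average_eq, smul_eq_mul, smul_eq_mul, mul_pow, inv_pow,
    inv_mul_le_iff₀ (by positivity)] at hjensen
  calc (∫ t, g t ∂μ) ^ 2 ≤ μ.real univ ^ 2 * ((μ.real univ)⁻¹ * ∫ t, g t ^ 2 ∂μ) := hjensen
    _ = μ.real univ * ∫ t, g t ^ 2 ∂μ := by field_simp

lemma sum_sq_sub_le_of_lipschitzWith {ι : Type*} (s : Finset ι) {f : ℝ → ℝ} {ν : NNReal}
    (hf : LipschitzWith ν f) (y x : ι → ℝ) :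
    ∑ k ∈ s, (f (y k) - f (x k)) ^ 2 ≤ (ν : ℝ) ^ 2 * ∑ k ∈ s, (y k - x k) ^ 2 := by
  rw [Finset.mul_sum]
  refine Finset.sum_le_sum fun k _ => ?_
  rw [← mul_pow, sq_le_sq, abs_mul, NNReal.abs_eq]
  exact hf.dist_le_mul (y k) (x k)

lemma absolutelyContinuousOnInterval_congr {X : Type*} [PseudoMetricSpace X] {f g : ℝ → X}
    {a b : ℝ} (hf : AbsolutelyContinuousOnInterval f a b) (hfg : EqOn f g (uIcc a b)) :
    AbsolutelyContinuousOnInterval g a b := by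
  rw [absolutelyContinuousOnInterval_iff] at hf ⊢
  intro ε hε
  obtain ⟨δ, hδ, h⟩ := hf ε hε
  refine ⟨δ, hδ, fun E hE hlt => (Finset.sum_congr rfl fun i hi => ?_).trans_lt (h E hE hlt)⟩
  have hmem := hE.1 i hi
  rw [hfg hmem.1, hfg hmem.2]

lemma uIcc_subset_domain {a b : ℝ} (ha : a ∈ domain) (hb : b ∈ domain) : uIcc a b ⊆ domain :=
  ordConnected_Ioo.uIcc_subset ha hb

lemma zero_mem_domain : (0 : ℝ) ∈ domain := by constructor <;> norm_num

lemma exists_abs_le_of_lipschitzOnWith {s : Set ℝ} (hs : Bornology.IsBounded s) {g : ℝ → ℝ}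
    {M : NNReal} (hg : LipschitzOnWith M g s) : ∃ C, ∀ t ∈ s, |g t| ≤ C := by
  obtain ⟨g', hg', heq⟩ := hg.extend_real
  obtain ⟨C, hC⟩ := (hg'.isBounded_image hs).exists_norm_le
  exact ⟨C, fun t ht => heq ht ▸ hC _ (mem_image_of_mem g' ht)⟩

lemma memLp_deriv_mul_of_lipschitzOnWith {g w : ℝ → ℝ} {M : NNReal} {C : ℝ}
    (hg : LipschitzOnWith M g domain) (hwC : ∀ t ∈ domain, |w t| ≤ C)
    (hwd : ∀ᵐ t, t ∈ domain → DifferentiableAt ℝ w t)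
    (hw : MemLp (deriv w) 2 (volume.restrict domain)) :
    MemLp (deriv (g * w)) 2 (volume.restrict domain) := by
  obtain ⟨G, hG⟩ := exists_abs_le_of_lipschitzOnWith (Metric.isBounded_Ioo (-1) 1) hg
  have hconst : MemLp (fun _ : ℝ => M * C) 2 (volume.restrict (Ioo (-1 : ℝ) 1)) := memLp_const _
  refine (hconst.add (hw.norm.const_mul G)).mono (measurable_deriv _).aestronglyMeasurable ?_
  refine (ae_restrict_iff' measurableSet_Ioo).2 ?_
  filter_upwards [hwd, hg.ae_differentiableWithinAt_of_mem_real] with t hwt hgt ht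
  have hnhds : domain ∈ 𝓝 t := isOpen_Ioo.mem_nhds ht
  have hg't : |deriv g t| ≤ M := norm_deriv_le_of_lipschitzOn hnhds hg
  rw [deriv_mul ((hgt ht).differentiableAt hnhds) (hwt ht)]
  calc |deriv g t * w t + g t * deriv w t|
      ≤ |deriv g t| * |w t| + |g t| * |deriv w t| := by
        simpa only [abs_mul] using abs_add_le (deriv g t * w t) (g t * deriv w t)
    _ ≤ M * C + G * |deriv w t| := by gcongr; exacts [hwC t ht, hG t ht]
    _ ≤ |M * C + G * ‖deriv w t‖| := le_abs_self _

lemma roughness_nonneg (u : ℝ → ℝ) : 0 ≤ roughness u :=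
  integral_nonneg fun _ => sq_nonneg _

namespace MemH2

variable {u v : ℝ → ℝ}

lemma differentiableAt (hu : MemH2 u) {t : ℝ} (ht : t ∈ domain) : DifferentiableAt ℝ u t :=
  (hu.differentiableOn t ht).differentiableAt (isOpen_Ioo.mem_nhds ht)

lemma ae_differentiableAt_deriv (hu : MemH2 u) :
    ∀ᵐ t, t ∈ domain → DifferentiableAt ℝ (deriv u) t := by
  refine ae_of_mem_of_ae_of_mem_inter_Ioo fun a b ha hb _ => ?_
  filter_upwards [(hu.absolutelyContinuous_deriv a ha b hb).ae_differentiableAt] with t h ht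
  exact h (Icc_subset_uIcc (Ioo_subset_Icc_self ht.2))

lemma sq_deriv_sub_le (hu : MemH2 u) {a b : ℝ} (ha : a ∈ domain) (hb : b ∈ domain) :
    (deriv u b - deriv u a) ^ 2 ≤ |b - a| * roughness u := by
  wlog hab : a ≤ b generalizing a b
  · rw [abs_sub_comm, ← neg_sub, neg_sq]
    exact this hb ha (le_of_not_ge hab)
  have hac := hu.absolutelyContinuous_deriv a ha b hb
  have hsub : Ioc a b ⊆ domain := fun x hx => ⟨ha.1.trans hx.1, hx.2.trans_lt hb.2⟩
  calc (deriv u b - deriv u a) ^ 2 = (∫ t in Ioc a b, deriv (deriv u) t) ^ 2 := by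
        rw [← hac.integral_deriv_eq_sub, intervalIntegral.integral_of_le hab]
    _ ≤ (b - a) * ∫ t in Ioc a b, deriv (deriv u) t ^ 2 := by
        simpa [hab] using sq_integral_le_measureReal_mul_integral_sq
          (hu.memLp_deriv_deriv.mono_measure (Measure.restrict_mono_set volume hsub))
    _ ≤ |b - a| * roughness u := by
        rw [abs_of_nonneg (sub_nonneg.2 hab)]
        exact mul_le_mul_of_nonneg_left
          (setIntegral_mono_set hu.memLp_deriv_deriv.integrable_sq
            (ae_of_all _ fun _ => sq_nonneg _) hsub.eventuallyLE) (sub_nonneg.2 hab)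

lemma exists_abs_deriv_le (hu : MemH2 u) : ∃ M : NNReal, ∀ t ∈ domain, |deriv u t| ≤ M := by
  refine ⟨⟨|deriv u 0| + √(roughness u), by positivity⟩, fun t ht => ?_⟩
  have hincr : |deriv u t - deriv u 0| ≤ √(roughness u) := by
    refine Real.abs_le_sqrt ((hu.sq_deriv_sub_le zero_mem_domain ht).trans ?_)
    rw [sub_zero]
    exact mul_le_of_le_one_left (roughness_nonneg u) (abs_le.2 ⟨ht.1.le, ht.2.le⟩)
  calc |deriv u t| = |deriv u 0 + (deriv u t - deriv u 0)| := by rw [add_sub_cancel]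
    _ ≤ |deriv u 0| + |deriv u t - deriv u 0| := abs_add_le _ _
    _ ≤ |deriv u 0| + √(roughness u) := by gcongr

lemma exists_lipschitzOnWith (hu : MemH2 u) : ∃ M : NNReal, LipschitzOnWith M u domain :=
  hu.exists_abs_deriv_le.imp fun _ hM =>
    (convex_Ioo (-1 : ℝ) 1).lipschitzOnWith_of_nnnorm_deriv_le
      (fun _ hx => hu.differentiableAt hx) fun x hx => hM x hx

lemma comp (hu : MemH2 u) {f : ℝ → ℝ} {η : NNReal} (hf : Differentiable ℝ f)
    (hf' : LipschitzWith η (deriv f)) : MemH2 (f ∘ u) := by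
  obtain ⟨M, hM⟩ := hu.exists_lipschitzOnWith
  obtain ⟨C, hC⟩ := hu.exists_abs_deriv_le
  have hlip : LipschitzOnWith (η * M) (deriv f ∘ u) domain := hf'.comp_lipschitzOnWith hM
  have hchain : EqOn (deriv (f ∘ u)) ((deriv f ∘ u) * deriv u) domain := fun t ht =>
    deriv_comp t (hf _) (hu.differentiableAt ht)
  refine ⟨hf.comp_differentiableOn hu.differentiableOn, fun a ha b hb => ?_, ?_⟩
  · have hsub := uIcc_subset_domain ha hb
    exact absolutelyContinuousOnInterval_congr
      ((hlip.mono hsub).absolutelyContinuousOnInterval.mul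
        (hu.absolutelyContinuous_deriv a ha b hb))
      (hchain.symm.mono hsub)
  · refine (memLp_deriv_mul_of_lipschitzOnWith hlip hC hu.ae_differentiableAt_deriv
      hu.memLp_deriv_deriv).ae_eq ?_
    exact (ae_restrict_iff' measurableSet_Ioo).2 <| ae_of_all _ fun t ht =>
      (hchain.symm.eventuallyEq_of_mem (isOpen_Ioo.mem_nhds ht)).deriv_eq

lemma eqOn_deriv_sub (hu : MemH2 u) (hv : MemH2 v) :
    EqOn (deriv (u - v)) (deriv u - deriv v) domain := fun _ ht =>
  deriv_sub (hu.differentiableAt ht) (hv.differentiableAt ht)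

lemma deriv_deriv_sub_ae_eq (hu : MemH2 u) (hv : MemH2 v) :
    deriv (deriv (u - v)) =ᵐ[volume.restrict domain] deriv (deriv u) - deriv (deriv v) := by
  refine (ae_restrict_iff' measurableSet_Ioo).2 ?_
  filter_upwards [hu.ae_differentiableAt_deriv, hv.ae_differentiableAt_deriv] with t hut hvt ht
  rw [((hu.eqOn_deriv_sub hv).eventuallyEq_of_mem (isOpen_Ioo.mem_nhds ht)).deriv_eq,
    deriv_sub (hut ht) (hvt ht), Pi.sub_apply]

lemma sub (hu : MemH2 u) (hv : MemH2 v) : MemH2 (u - v) where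
  differentiableOn := hu.differentiableOn.sub hv.differentiableOn
  absolutelyContinuous_deriv a ha b hb := absolutelyContinuousOnInterval_congr
    ((hu.absolutelyContinuous_deriv a ha b hb).sub (hv.absolutelyContinuous_deriv a ha b hb))
    ((hu.eqOn_deriv_sub hv).symm.mono (uIcc_subset_domain ha hb))
  memLp_deriv_deriv := (hu.memLp_deriv_deriv.sub hv.memLp_deriv_deriv).ae_eq
    (hu.deriv_deriv_sub_ae_eq hv).symm

lemma roughness_sub_le (hu : MemH2 u) (hv : MemH2 v) :
    roughness (u - v) ≤ 2 * (roughness u + roughness v) := by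
  have hu2 := hu.memLp_deriv_deriv.integrable_sq
  have hv2 := hv.memLp_deriv_deriv.integrable_sq
  calc roughness (u - v)
      ≤ ∫ t in domain, 2 * (deriv (deriv u) t ^ 2 + deriv (deriv v) t ^ 2) := by
        refine integral_mono_ae (hu.sub hv).memLp_deriv_deriv.integrable_sq
          ((hu2.add hv2).const_mul 2) ?_
        filter_upwards [hu.deriv_deriv_sub_ae_eq hv] with t ht
        rw [ht, Pi.sub_apply]
        simpa only [neg_sq, ← sub_eq_add_neg] using
          add_sq_le (a := deriv (deriv u) t) (b := -deriv (deriv v) t)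
    _ = 2 * (roughness u + roughness v) := by
        rw [integral_const_mul, integral_add hu2 hv2, roughness, roughness]

lemma exists_mem_uIcc_sub_eq_deriv_mul (hu : MemH2 u) {x y : ℝ} (hx : x ∈ domain)
    (hy : y ∈ domain) : ∃ ξ ∈ uIcc x y, u y - u x = deriv u ξ * (y - x) := by
  obtain ⟨ξ, hξ, h⟩ := domain_mvt (s := domain)
    (fun z hz => (hu.differentiableAt hz).hasDerivAt.hasFDerivAt.hasFDerivWithinAt)
    (convex_Ioo _ _) hx hy
  exact ⟨ξ, segment_eq_uIcc x y ▸ hξ, by simpa [mul_comm] using h⟩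

lemma sq_sub_secant_le (hu : MemH2 u) {a b s : ℝ} (ha : a ∈ domain) (hb : b ∈ domain)
    (hs : s ∈ domain) (hab : a ≠ b) :
    (u s - (u a + (u b - u a) / (b - a) * (s - a))) ^ 2
      ≤ (|s - a| + |b - a|) * (s - a) ^ 2 * roughness u := by
  -- By the mean value theorem both slopes are values of `u'`, so only their difference matters.
  obtain ⟨ξ, hξ, hus⟩ := hu.exists_mem_uIcc_sub_eq_deriv_mul ha hs
  obtain ⟨ζ, hζ, hub⟩ := hu.exists_mem_uIcc_sub_eq_deriv_mul ha hb
  have hdist : |ξ - ζ| ≤ |s - a| + |b - a| :=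
    (abs_sub_le ξ a ζ).trans (add_le_add (abs_sub_left_of_mem_uIcc hξ)
      (abs_sub_comm ζ a ▸ abs_sub_left_of_mem_uIcc hζ))
  calc (u s - (u a + (u b - u a) / (b - a) * (s - a))) ^ 2
      = (deriv u ξ - deriv u ζ) ^ 2 * (s - a) ^ 2 := by
        rw [hub, mul_div_cancel_right₀ _ (sub_ne_zero.2 hab.symm), ← sub_sub, hus]
        ring
    _ ≤ (|s - a| + |b - a|) * roughness u * (s - a) ^ 2 := by
        gcongr
        exact (hu.sq_deriv_sub_le (uIcc_subset_domain ha hb hζ)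
          (uIcc_subset_domain ha hs hξ)).trans (by gcongr; exact roughness_nonneg u)
    _ = (|s - a| + |b - a|) * (s - a) ^ 2 * roughness u := by ring

lemma sq_le_mul_add_mul_roughness (hu : MemH2 u) {a b s L E : ℝ} (ha : a ∈ domain) (hb : b ∈ domain)
    (hs : s ∈ domain) (hL : 0 < L) (hsa : |s - a| ≤ L) (hLb : L ≤ |b - a|) (hbL : |b - a| ≤ 3 * L)
    (hEa : u a ^ 2 ≤ E) (hEb : u b ^ 2 ≤ E) :
    u s ^ 2 ≤ 15 * E + 12 * L ^ 3 * roughness u := by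
  have hba : 0 < |b - a| := hL.trans_le hLb
  have hab : b - a ≠ 0 := abs_pos.1 hba
  set θ := (s - a) / (b - a) with hθ
  set r := u s - (u a + (u b - u a) / (b - a) * (s - a)) with hr
  have hθ1 : |θ| ≤ 1 := by
    rw [abs_div]
    exact div_le_one_of_le₀ (hsa.trans hLb) (abs_nonneg _)
  have hr2 : r ^ 2 ≤ 4 * L ^ 3 * roughness u := by
    have hR := roughness_nonneg u
    calc r ^ 2 ≤ (|s - a| + |b - a|) * |s - a| ^ 2 * roughness u := by
          rw [sq_abs]
          exact hu.sq_sub_secant_le ha hb hs (sub_ne_zero.1 hab).symm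
      _ ≤ (L + 3 * L) * L ^ 2 * roughness u := by gcongr
      _ = 4 * L ^ 3 * roughness u := by ring
  have hsplit : u s = (1 - θ) * u a + θ * u b + r := by
    rw [hr, hθ]
    field_simp
    ring
  obtain ⟨hθl, hθu⟩ := abs_le.1 hθ1
  have hwa : ((1 - θ) * u a) ^ 2 ≤ 4 * E := by
    rw [mul_pow]
    exact mul_le_mul (by nlinarith) hEa (sq_nonneg _) (by norm_num)
  have hwb : (θ * u b) ^ 2 ≤ E := by
    rw [mul_pow]
    exact (mul_le_of_le_one_left (sq_nonneg _) ((sq_le_one_iff_abs_le_one θ).2 hθ1)).trans hEb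
  calc u s ^ 2 ≤ 3 * (((1 - θ) * u a) ^ 2 + (θ * u b) ^ 2 + r ^ 2) := by
        rw [hsplit]
        nlinarith [sq_nonneg ((1 - θ) * u a - θ * u b), sq_nonneg ((1 - θ) * u a - r),
          sq_nonneg (θ * u b - r)]
    _ ≤ 3 * (4 * E + E + 4 * L ^ 3 * roughness u) := by gcongr
    _ = 15 * E + 12 * L ^ 3 * roughness u := by ring

end MemH2

namespace IsSmoothingSpline

variable {N : ℕ} {F : Finset (Fin N)} {t : Fin N → ℝ} {lam : ℝ} {u h : ℝ → ℝ}

lemma splineLoss_le (hs : IsSmoothingSpline F t (fun n => h (t n)) lam u) (hh : MemH2 h) :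
    splineLoss F t (fun n => h (t n)) lam u ≤ lam * roughness h := by
  simpa [splineLoss] using hs.isMin h hh

lemma sum_sq_residual_le (hs : IsSmoothingSpline F t (fun n => h (t n)) lam u) (hh : MemH2 h)
    (hlam : 0 ≤ lam) :
    1 / (F.card : ℝ) * ∑ v ∈ F, (u (t v) - h (t v)) ^ 2 ≤ lam * roughness h := by
  have hloss := hs.splineLoss_le hh
  rw [splineLoss] at hloss
  linarith [mul_nonneg hlam (roughness_nonneg u)]

lemma roughness_le (hs : IsSmoothingSpline F t (fun n => h (t n)) lam u) (hh : MemH2 h)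
    (hlam : 0 ≤ lam) : roughness u ≤ roughness h := by
  have hres : 0 ≤ 1 / (F.card : ℝ) * ∑ v ∈ F, (u (t v) - h (t v)) ^ 2 := by positivity
  rcases hlam.eq_or_lt with rfl | hpos
  · refine hs.isMin_roughness rfl h hh (le_antisymm ?_ (hs.isMin h hh))
    simpa [splineLoss] using hres
  · have hloss := hs.splineLoss_le hh
    rw [splineLoss] at hloss
    exact le_of_mul_le_mul_left (by linarith) hpos

lemma sq_residual_le (hs : IsSmoothingSpline F t (fun n => h (t n)) lam u) (hh : MemH2 h)
    (hlam : 0 ≤ lam) {v : Fin N} (hv : v ∈ F) :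
    (u (t v) - h (t v)) ^ 2 ≤ N * lam * roughness h := by
  have hcard : (0 : ℝ) < F.card := by exact_mod_cast Finset.card_pos.2 ⟨v, hv⟩
  have hsum := hs.sum_sq_residual_le hh hlam
  rw [one_div, inv_mul_le_iff₀ hcard] at hsum
  calc (u (t v) - h (t v)) ^ 2 ≤ ∑ w ∈ F, (u (t w) - h (t w)) ^ 2 :=
        Finset.single_le_sum (f := fun w => (u (t w) - h (t w)) ^ 2) (fun _ _ => sq_nonneg _) hv
    _ ≤ F.card * (lam * roughness h) := hsum
    _ ≤ N * (lam * roughness h) := by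
        have hR := roughness_nonneg h
        gcongr
        simpa using F.card_le_univ
    _ = N * lam * roughness h := (mul_assoc _ _ _).symm

end IsSmoothingSpline

section Mesh

variable {N : ℕ} {β : Fin N → ℝ}

lemma node_succ (β : Fin N → ℝ) (n : Fin N) : node β (n + 1) = β n := by
  simp [node]

lemma node_last (β : Fin N → ℝ) : node β (N + 1) = 1 := by
  simp [node]

lemma node_sub_le_gapMax {n : ℕ} (hn : n ≤ N) : node β (n + 1) - node β n ≤ gapMax β :=
  le_ciSup (f := fun k : Fin (N + 1) => node β (k + 1) - node β k)
    (Set.finite_range _).bddAbove ⟨n, by omega⟩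

lemma gapMin_le_node_sub {n : ℕ} (hn : n + 1 < N) : gapMin β ≤ node β (n + 2) - node β (n + 1) :=
  ciInf_le (f := fun k : Fin (N - 1) => node β (k + 2) - node β (k + 1))
    (Set.finite_range _).bddBelow ⟨n, by omega⟩

lemma node_add_le {i j : ℕ} (hij : i + j ≤ N + 1) :
    node β (i + j) ≤ node β i + j * gapMax β := by
  induction j with
  | zero => simp
  | succ j ih =>
    have hgap := node_sub_le_gapMax (β := β) (n := i + j) (by omega)
    push_cast
    rw [← add_assoc]
    linarith [ih (by omega)]

lemma gapMax_pos (β : Fin N → ℝ) : 0 < gapMax β := by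
  have hlen : node β (0 + (N + 1)) ≤ node β 0 + (N + 1 : ℕ) * gapMax β := node_add_le (by omega)
  rw [zero_add, node_last, node] at hlen
  exact pos_of_mul_pos_right (by linarith) (Nat.cast_nonneg (N + 1))

lemma gapMin_pos (hN : 2 ≤ N) (hβ : StrictMono β) : 0 < gapMin β := by
  have : Nonempty (Fin (N - 1)) := ⟨⟨0, by omega⟩⟩
  obtain ⟨k, hk⟩ := exists_eq_ciInf_of_finite
    (f := fun k : Fin (N - 1) => node β (k + 2) - node β (k + 1))
  rw [gapMin, ← hk, sub_pos]
  have hleft : node β (k + 1) = β ⟨k, by omega⟩ := node_succ β ⟨k, by omega⟩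
  have hright : node β (k + 2) = β ⟨k + 1, by omega⟩ := node_succ β ⟨k + 1, by omega⟩
  rw [hleft, hright]
  exact hβ (by simp)

lemma natCast_mul_gapMin_le {n : ℕ} (hn : n < N) :
    n * gapMin β ≤ node β (n + 1) - node β 1 := by
  induction n with
  | zero => simp
  | succ n ih =>
    push_cast
    linarith [ih (by omega), gapMin_le_node_sub (β := β) hn]

lemma natCast_mul_gapMin_le_four (hN : 2 ≤ N) (hβ : StrictMono β) (hβΩ : ∀ n, β n ∈ domain) :
    N * gapMin β ≤ 4 := by
  obtain ⟨n, rfl⟩ : ∃ n, N = n + 1 := ⟨N - 1, by omega⟩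
  have hspan := natCast_mul_gapMin_le (β := β) n.lt_succ_self
  have hfirst : node β 1 = β 0 := node_succ β 0
  have hlast : node β (n + 1) = β (Fin.last n) := node_succ β (Fin.last n)
  rw [hfirst, hlast] at hspan
  have hn : (1 : ℝ) ≤ n := by exact_mod_cast (by omega : 1 ≤ n)
  push_cast
  nlinarith [(hβΩ 0).1, (hβΩ (Fin.last n)).2, gapMin_pos hN hβ]

lemma gapMax_le_div {B : ℝ} (hB : 0 ≤ B) (hN : 2 ≤ N) (hβ : StrictMono β)
    (hβΩ : ∀ n, β n ∈ domain) (hgap : gapMax β / gapMin β ≤ B) : gapMax β ≤ 4 * B / N := by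
  rw [div_le_iff₀ (gapMin_pos hN hβ)] at hgap
  rw [le_div_iff₀ (by positivity)]
  calc gapMax β * N ≤ B * gapMin β * N := by gcongr
    _ = B * (N * gapMin β) := by ring
    _ ≤ B * 4 := by gcongr; exact natCast_mul_gapMin_le_four hN hβ hβΩ
    _ = 4 * B := mul_comm _ _

lemma exists_mem_Icc_node (β : Fin N → ℝ) {s : ℝ} (hs : -1 ≤ s) (hs1 : s ≤ 1) :
    ∃ i ≤ N, s ∈ Icc (node β i) (node β (i + 1)) := by
  by_contra! hno
  have hbelow : ∀ i ≤ N + 1, node β i ≤ s := by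
    intro i
    induction i with
    | zero => exact fun _ => hs
    | succ i ih =>
      exact fun hi => le_of_not_ge fun hle => hno i (by omega) ⟨ih (by omega), hle⟩
  exact hno N le_rfl ⟨hbelow N (by omega), (node_last β).symm ▸ hs1⟩

/-- The index set `F ⊆ {0, …, N - 1}` meets every window `{i, …, i + m - 1}` of `m` consecutive
indices. For the set of non-stragglers this says that every run of consecutive stragglers is
shorter than `m`. -/
def HitsWindows (F : Finset (Fin N)) (m : ℕ) : Prop :=
  ∀ i : ℕ, i + m ≤ N → ∃ v ∈ F, (v : ℕ) ∈ Finset.Ico i (i + m)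

namespace HitsWindows

variable {F : Finset (Fin N)} {m : ℕ}

lemma pos (hF : HitsWindows F m) : 0 < m := by
  by_contra hm
  obtain ⟨v, -, hv⟩ := hF 0 (by omega)
  rw [Finset.mem_Ico] at hv
  omega

lemma exists_mem_Icc (hF : HitsWindows F m) (hβ : StrictMono β) {L s : ℝ}
    (hL : m * gapMax β ≤ L) (hs : -1 ≤ s) (hsL : s + L < 1) : ∃ v ∈ F, β v ∈ Icc s (s + L) := by
  have hg := gapMax_pos β
  have hL0 : 0 ≤ L := (by positivity : 0 ≤ m * gapMax β).trans hL
  obtain ⟨i, hiN, his, hsi⟩ := exists_mem_Icc_node β hs (by linarith)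
  have hnode : ∀ j ≤ m, i + j ≤ N + 1 → node β (i + j) ≤ s + L := fun j hj hij =>
    calc node β (i + j) ≤ node β i + j * gapMax β := node_add_le hij
      _ ≤ s + m * gapMax β := by gcongr
      _ ≤ s + L := by gcongr
  have him : i + m ≤ N := by
    by_contra hcon
    have hlast := hnode (N + 1 - i) (by omega) (by omega)
    rw [show i + (N + 1 - i) = N + 1 by omega, node_last] at hlast
    linarith
  obtain ⟨v, hv, hiv⟩ := hF i him
  obtain ⟨hiv, hvm⟩ := Finset.mem_Ico.1 hiv
  refine ⟨v, hv, hsi.trans ?_, ?_⟩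
  · exact (node_succ β ⟨i, by omega⟩).trans_le (hβ.monotone hiv)
  · have hv1 := hnode (v + 1 - i) (by omega) (by omega)
    rwa [show i + (v + 1 - i) = v + 1 by omega, node_succ] at hv1

lemma nonempty (hF : HitsWindows F m) (hβ : StrictMono β) {L : ℝ} (hL : m * gapMax β ≤ L)
    (hL2 : L < 2) : F.Nonempty :=
  (hF.exists_mem_Icc hβ hL le_rfl (by linarith)).imp fun _ hv => hv.1

lemma exists_separated_pair (hF : HitsWindows F m) (hβ : StrictMono β) {L s : ℝ}
    (hL : m * gapMax β ≤ L) (hL1 : 3 * L < 1) (hs : s ∈ domain) :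
    ∃ v ∈ F, ∃ w ∈ F, |s - β v| ≤ L ∧ L ≤ |β w - β v| ∧ |β w - β v| ≤ 3 * L := by
  have hnear := fun x => hF.exists_mem_Icc hβ hL (s := x)
  obtain ⟨hs1, hs2⟩ := hs
  simp only [abs_le, le_abs]
  rcases le_total s 0 with h0 | h0
  · obtain ⟨v, hv, hv1, hv2⟩ := hnear s (by linarith) (by linarith)
    obtain ⟨w, hw, hw1, hw2⟩ := hnear (s + 2 * L) (by linarith) (by linarith)
    exact ⟨v, hv, w, hw, by constructor <;> linarith, .inl (by linarith),
      by constructor <;> linarith⟩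
  · obtain ⟨v, hv, hv1, hv2⟩ := hnear (s - L) (by linarith) (by linarith)
    obtain ⟨w, hw, hw1, hw2⟩ := hnear (s - 3 * L) (by linarith) (by linarith)
    exact ⟨v, hv, w, hw, by constructor <;> linarith, .inr (by linarith),
      by constructor <;> linarith⟩

end HitsWindows

lemma IsSmoothingSpline.sq_sub_le_of_hitsWindows {F : Finset (Fin N)} {m : ℕ} {lam L s : ℝ}
    {u h : ℝ → ℝ} (hu : IsSmoothingSpline F β (fun n => h (β n)) lam u) (hh : MemH2 h)
    (hlam : 0 ≤ lam) (hF : HitsWindows F m) (hβ : StrictMono β) (hβΩ : ∀ n, β n ∈ domain)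
    (hL : m * gapMax β ≤ L) (hL1 : 3 * L < 1) (hs : s ∈ domain) :
    (u s - h s) ^ 2 ≤ (15 * (N * lam) + 48 * L ^ 3) * roughness h := by
  have hL0 : 0 < L := (mul_pos (Nat.cast_pos.2 hF.pos) (gapMax_pos β)).trans_le hL
  obtain ⟨v, hv, w, hw, hsv, hLw, hwL⟩ := hF.exists_separated_pair hβ hL hL1 hs
  have hrough : roughness (u - h) ≤ 4 * roughness h := by
    linarith [hu.memH2.roughness_sub_le hh, hu.roughness_le hh hlam]
  calc (u s - h s) ^ 2
      ≤ 15 * (N * lam * roughness h) + 12 * L ^ 3 * roughness (u - h) :=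
        (hu.memH2.sub hh).sq_le_mul_add_mul_roughness (hβΩ v) (hβΩ w) hs hL0 hsv hLw hwL
          (hu.sq_residual_le hh hlam hv) (hu.sq_residual_le hh hlam hw)
    _ ≤ 15 * (N * lam * roughness h) + 12 * L ^ 3 * (4 * roughness h) := by gcongr
    _ = (15 * (N * lam) + 48 * L ^ 3) * roughness h := by ring

end Mesh

section Stragglers

variable {S : Type*} [MeasurableSpace S] {P : Measure S} {N : ℕ} {straggler : Fin N → Set S}

lemma measure_window_subset_stragglers_le (hind : iIndepSet straggler P) {r : ENNReal}
    (hP : ∀ n, P (straggler n) ≤ r) {i m : ℕ} (him : i + m ≤ N) :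
    P {s | ∀ v : Fin N, (v : ℕ) ∈ Finset.Ico i (i + m) → s ∈ straggler v} ≤ r ^ m := by
  set W := (Finset.Ico i (i + m)).attachFin fun k hk => (Finset.mem_Ico.1 hk).2.trans_le him
    with hW
  have hWcard : W.card = m := by simp [hW]
  calc P {s | ∀ v : Fin N, (v : ℕ) ∈ Finset.Ico i (i + m) → s ∈ straggler v}
      = P (⋂ v ∈ W, straggler v) := by
        congr 1
        ext s
        simp only [hW, mem_ofPred_eq, mem_iInter, Finset.mem_attachFin]
    _ = ∏ v ∈ W, P (straggler v) := hind.meas_biInter W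
    _ ≤ r ^ m := hWcard ▸ Finset.prod_le_pow_card W _ r fun v _ => hP v

lemma measure_not_hitsWindows_le (hind : iIndepSet straggler P) {r : ENNReal}
    (hP : ∀ n, P (straggler n) ≤ r) {m : ℕ} (hm : 0 < m) :
    P {s | ¬ HitsWindows (nonStragglers straggler s) m} ≤ N * r ^ m := by
  set I := (Finset.range N).filter fun i => i + m ≤ N
  have hcover : {s | ¬ HitsWindows (nonStragglers straggler s) m} ⊆
      ⋃ i ∈ I, {s | ∀ v : Fin N, (v : ℕ) ∈ Finset.Ico i (i + m) → s ∈ straggler v} := by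
    intro s hs
    simp only [HitsWindows, mem_ofPred_eq, not_forall, not_exists, not_and] at hs
    obtain ⟨i, him, hmiss⟩ := hs
    have hiI : i ∈ I := Finset.mem_filter.2 ⟨Finset.mem_range.2 (by omega), him⟩
    refine mem_biUnion hiI fun v hv => ?_
    by_contra hvs
    exact hmiss v (by simpa [nonStragglers] using hvs) hv
  calc P {s | ¬ HitsWindows (nonStragglers straggler s) m}
      ≤ ∑ i ∈ I, P {s | ∀ v : Fin N, (v : ℕ) ∈ Finset.Ico i (i + m) → s ∈ straggler v} :=
        (measure_mono hcover).trans (measure_biUnion_finset_le _ _)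
    _ ≤ I.card • r ^ m := Finset.sum_le_card_nsmul _ _ _ fun i hi =>
        measure_window_subset_stragglers_le hind hP (Finset.mem_filter.1 hi).2
    _ ≤ N * r ^ m := by
        rw [nsmul_eq_mul]
        gcongr
        exact (Finset.card_filter_le _ _).trans_eq (Finset.card_range N)

lemma ofReal_one_sub_le_measure_hitsWindows [IsProbabilityMeasure P]
    (hind : iIndepSet straggler P) {p : ℝ} (hp : 0 ≤ p)
    (hP : ∀ n, P (straggler n) ≤ ENNReal.ofReal p) {m : ℕ} (hm : 0 < m) :
    ENNReal.ofReal (1 - N * p ^ m) ≤ P {s | HitsWindows (nonStragglers straggler s) m} := by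
  have hbad : P {s | HitsWindows (nonStragglers straggler s) m}ᶜ ≤ ENNReal.ofReal (N * p ^ m) := by
    rw [ENNReal.ofReal_mul N.cast_nonneg, ENNReal.ofReal_natCast, ENNReal.ofReal_pow hp]
    exact measure_not_hitsWindows_le hind hP hm
  rw [ENNReal.ofReal_sub _ (by positivity), ENNReal.ofReal_one, tsub_le_iff_right]
  calc 1 = P univ := measure_univ.symm
    _ ≤ P {s | HitsWindows (nonStragglers straggler s) m} +
          P {s | HitsWindows (nonStragglers straggler s) m}ᶜ := measure_univ_le_add_compl _
    _ ≤ _ := by gcongr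

end Stragglers

section WindowLength

lemma one_le_logb_add_sqrt {p q δ : ℝ} {N : ℕ} (hp : 0 < p) (hp1 : p < 1) (hδ : 0 < δ)
    (hδ1 : δ ≤ 1) (hqN : 1 ≤ q * N) : 1 ≤ Real.logb (1 / p) (q * N) + √(1 / δ) := by
  have hlogb : 0 ≤ Real.logb (1 / p) (q * N) := Real.logb_nonneg (one_lt_one_div hp hp1) hqN
  have hsqrt : 1 ≤ √(1 / δ) := Real.one_le_sqrt.2 (one_le_one_div hδ hδ1)
  linarith

lemma log_one_div_le_two_mul_sqrt {δ : ℝ} (hδ : 0 < δ) : Real.log (1 / δ) ≤ 2 * √(1 / δ) := by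
  have hlog : Real.log √(1 / δ) ≤ √(1 / δ) := Real.log_le_self (Real.sqrt_nonneg _)
  rw [Real.log_sqrt (by positivity)] at hlog
  linarith

lemma exists_pow_le_and_le_logb {p x : ℝ} (hp : 0 < p) (hp1 : p < 1) (hx : 0 < x) (hx1 : x ≤ 1) :
    ∃ m : ℕ, 0 < m ∧ p ^ m ≤ x ∧ m ≤ Real.logb (1 / p) (1 / x) + 1 := by
  have hb : 1 < 1 / p := one_lt_one_div hp hp1
  refine ⟨⌊Real.logb (1 / p) (1 / x)⌋₊ + 1, Nat.succ_pos _, ?_, ?_⟩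
  · have hpow : 1 / x ≤ (1 / p) ^ (⌊Real.logb (1 / p) (1 / x)⌋₊ + 1) := by
      rw [← Real.rpow_natCast, ← Real.logb_le_iff_le_rpow hb (by positivity)]
      exact_mod_cast (Nat.lt_floor_add_one _).le
    rwa [one_div_pow, one_div_le_one_div hx (by positivity)] at hpow
  · push_cast
    gcongr
    exact Nat.floor_le (Real.logb_nonneg hb (one_le_one_div hx hx1))

lemma logb_div_le {b q δ y : ℝ} (hb : 1 < b) (hq : 0 < q) (hδ : 0 < δ) (hδ1 : δ ≤ 1) (hy : 0 < y) :
    Real.logb b (y / δ) ≤ Real.logb b (q * y) + (1 / q + 2) / Real.log b * √(1 / δ) := by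
  have hl : 0 < Real.log b := Real.log_pos hb
  have hsplit : Real.logb b (y / δ) =
      Real.logb b (q * y) + (Real.log (1 / q) + Real.log (1 / δ)) / Real.log b := by
    rw [Real.logb, Real.logb, ← add_div, ← Real.log_mul (by positivity) (by positivity),
      ← Real.log_mul (by positivity) (by positivity)]
    congr 2
    field_simp
  have hnum : Real.log (1 / q) + Real.log (1 / δ) ≤ (1 / q + 2) * √(1 / δ) := by
    have hlq : Real.log (1 / q) ≤ 1 / q := Real.log_le_self (by positivity)
    have hq' : 1 / q ≤ 1 / q * √(1 / δ) :=
      le_mul_of_one_le_right (by positivity) (Real.one_le_sqrt.2 (one_le_one_div hδ hδ1))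
    linarith [log_one_div_le_two_mul_sqrt hδ]
  rw [hsplit, div_mul_eq_mul_div]
  gcongr

lemma exists_window_length {p q : ℝ} (hp : 0 < p) (hp1 : p < 1) (hq : 0 < q) :
    ∃ A : ℝ, 0 < A ∧ ∀ (δ : ℝ) (N : ℕ), 0 < δ → δ ≤ 1 → 1 ≤ q * N →
      ∃ m : ℕ, 0 < m ∧ N * p ^ m ≤ δ ∧
        m ≤ A * (Real.logb (1 / p) (q * N) + √(1 / δ)) := by
  have hb : 1 < 1 / p := one_lt_one_div hp hp1
  have hl : 0 < Real.log (1 / p) := Real.log_pos hb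
  set D := (1 / q + 2) / Real.log (1 / p)
  have : 0 < D := by positivity
  refine ⟨1 + D, by positivity, fun δ N hδ hδ1 hqN => ?_⟩
  have hN : (0 : ℝ) < N := pos_of_mul_pos_right (by linarith) hq.le
  have hN1 : (1 : ℝ) ≤ N := by exact_mod_cast Nat.cast_pos.1 hN
  obtain ⟨m, hm, hpow, hlen⟩ := exists_pow_le_and_le_logb hp hp1 (div_pos hδ hN)
    (div_le_one_of_le₀ (hδ1.trans hN1) hN.le)
  refine ⟨m, hm, (le_div_iff₀' hN).1 hpow, ?_⟩
  have hX : 0 ≤ Real.logb (1 / p) (q * N) := Real.logb_nonneg hb hqN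
  have hs : 1 ≤ √(1 / δ) := Real.one_le_sqrt.2 (one_le_one_div hδ hδ1)
  rw [one_div_div] at hlen
  calc (m : ℝ) ≤ Real.logb (1 / p) (q * N) + D * √(1 / δ) + √(1 / δ) :=
        hlen.trans (add_le_add (logb_div_le hb hq hδ hδ1 hN) hs)
    _ ≤ Real.logb (1 / p) (q * N) + D * √(1 / δ) + √(1 / δ) +
          D * Real.logb (1 / p) (q * N) := le_add_of_nonneg_right (by positivity)
    _ = (1 + D) * (Real.logb (1 / p) (q * N) + √(1 / δ)) := by ring

lemma tendsto_logb_mul_add_div {q : ℝ} (hq : q ≠ 0) (b c : ℝ) :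
    Tendsto (fun N : ℕ => (Real.logb b (q * N) + c) / N) atTop (𝓝 0) := by
  have hlog : Tendsto (fun N : ℕ => Real.log N / N) atTop (𝓝 0) :=
    Real.isLittleO_log_id_atTop.tendsto_div_nhds_zero.comp tendsto_natCast_atTop_atTop
  have hsum := (hlog.div_const (Real.log b)).add
    (tendsto_const_div_atTop_nhds_zero_nat (Real.log q / Real.log b + c))
  rw [zero_div, add_zero] at hsum
  refine hsum.congr' ?_
  filter_upwards [eventually_ne_atTop 0] with N hN
  rw [Real.logb, Real.log_mul hq (Nat.cast_ne_zero.2 hN)]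
  ring

lemma eventually_logb_mul_add_div_lt {q : ℝ} (hq : 0 < q) (b c : ℝ) {ε : ℝ} (hε : 0 < ε) :
    ∀ᶠ N : ℕ in atTop, 2 ≤ N ∧ 1 ≤ q * (N : ℝ) ∧ (Real.logb b (q * N) + c) / N < ε :=
  (eventually_ge_atTop 2).and <|
    ((tendsto_natCast_atTop_atTop.const_mul_atTop hq).eventually_ge_atTop 1).and <|
      (tendsto_logb_mul_add_div hq.ne' b c).eventually_lt_const hε

end WindowLength

lemma natCast_mul_le_div_cube {N : ℕ} {lam T : ℝ} (hlam : lam ≤ 1 / (N : ℝ) ^ 4) (hT : 1 ≤ T) :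
    N * lam ≤ T ^ 3 / N ^ 3 := by
  rcases N.eq_zero_or_pos with rfl | hN
  · simp
  calc N * lam ≤ N * (1 / (N : ℝ) ^ 4) := by gcongr
    _ = 1 / N ^ 3 := by field_simp
    _ ≤ T ^ 3 / N ^ 3 := by gcongr; exact one_le_pow₀ hT

lemma avgError_le {K : ℕ} (hK : 0 < K) {f h u : ℝ → ℝ} {α x : Fin K → ℝ} {E : ℝ}
    (hE : ∀ k, (u (α k) - h (α k)) ^ 2 ≤ E) :
    avgError f α x u ≤ 2 * E + 2 / (K : ℝ) * ∑ k, (h (α k) - f (x k)) ^ 2 := by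
  have hterm (k : Fin K) :
      (u (α k) - f (x k)) ^ 2 ≤ 2 * (E + (h (α k) - f (x k)) ^ 2) :=
    calc (u (α k) - f (x k)) ^ 2 = ((u (α k) - h (α k)) + (h (α k) - f (x k))) ^ 2 := by ring
      _ ≤ 2 * ((u (α k) - h (α k)) ^ 2 + (h (α k) - f (x k)) ^ 2) := add_sq_le
      _ ≤ 2 * (E + (h (α k) - f (x k)) ^ 2) := by gcongr; exact hE k
  calc avgError f α x u ≤ 1 / (K : ℝ) * ∑ k, 2 * (E + (h (α k) - f (x k)) ^ 2) :=
        mul_le_mul_of_nonneg_left (Finset.sum_le_sum fun k _ => hterm k) (by positivity)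
    _ = 2 * E + 2 / (K : ℝ) * ∑ k, (h (α k) - f (x k)) ^ 2 := by
        rw [← Finset.mul_sum, Finset.sum_add_distrib, Finset.sum_const, Finset.card_univ,
          Fintype.card_fin, nsmul_eq_mul]
        field_simp

lemma avgError_le_of_lipschitzWith {K : ℕ} (hK : 0 < K) {f g u : ℝ → ℝ} {ν : NNReal}
    (hf : LipschitzWith ν f) {α x : Fin K → ℝ} {E : ℝ}
    (hE : ∀ k, (u (α k) - (f ∘ g) (α k)) ^ 2 ≤ E) :
    avgError f α x u ≤ 2 * E + 2 * (ν : ℝ) ^ 2 / (K : ℝ) * ∑ k, (g (α k) - x k) ^ 2 := by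
  refine (avgError_le (x := x) (f := f) hK hE).trans (add_le_add_right ?_ _)
  calc 2 / (K : ℝ) * ∑ k, (f (g (α k)) - f (x k)) ^ 2
      ≤ 2 / (K : ℝ) * ((ν : ℝ) ^ 2 * ∑ k, (g (α k) - x k) ^ 2) := by
        gcongr
        exact sum_sq_sub_le_of_lipschitzWith _ hf (fun k => g (α k)) x
    _ = 2 * (ν : ℝ) ^ 2 / (K : ℝ) * ∑ k, (g (α k) - x k) ^ 2 := by ring

end LeTCC

theorem theorem1_general (p q B : ℝ) (hpq : p = 1 - q) (hp : 0 < p) (hq : 0 < q) (hB : 0 < B) :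
    ∃ C : ℝ, 0 < C ∧ ∀ δ : ℝ, 0 < δ → δ < 1 → ∃ n₀ : ℕ, ∀ N : ℕ, n₀ < N →
      ∀ h : ℝ → ℝ, LeTCC.MemH2 h →
      ∀ β : Fin N → ℝ, StrictMono β → (∀ n, β n ∈ LeTCC.domain) →
        LeTCC.gapMax β / LeTCC.gapMin β ≤ B →
      ∀ lam : ℝ, 0 ≤ lam → lam ≤ 1 / (N : ℝ) ^ 4 →
      ∀ udec : Finset (Fin N) → ℝ → ℝ,
        (∀ F : Finset (Fin N), F.Nonempty →
          LeTCC.IsSmoothingSpline F β (fun n => h (β n)) lam (udec F)) →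
      ∀ (S : Type*) [MeasurableSpace S] (P : Measure S) [IsProbabilityMeasure P]
        (straggler : Fin N → Set S),
        iIndepSet straggler P → (∀ n, P (straggler n) ≤ ENNReal.ofReal p) →
      ENNReal.ofReal (1 - δ) ≤ P {s | ∀ t ∈ LeTCC.domain,
        (udec (LeTCC.nonStragglers straggler s) t - h t) ^ 2 ≤
          C * ((Real.logb (1 / p) (q * N) + √(1 / δ)) ^ 3 / (N : ℝ) ^ 3) *
            LeTCC.roughness h} := by
  have hp1 : p < 1 := by linarith
  obtain ⟨A, hA, hwindow⟩ := LeTCC.exists_window_length hp hp1 hq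
  refine ⟨15 + 48 * (4 * A * B) ^ 3, by positivity, fun δ hδ hδ1 => ?_⟩
  obtain ⟨n₀, hn₀⟩ := eventually_atTop.1 <|
    LeTCC.eventually_logb_mul_add_div_lt hq (1 / p) √(1 / δ)
      (by positivity : 0 < 1 / (3 * (4 * A * B)))
  refine ⟨n₀, fun N hN h hh β hβ hβΩ hgap lam hlam hlam4 udec hudec S _ P _ straggler hind hP => ?_⟩
  obtain ⟨hN2, hqN, hsmall⟩ := hn₀ N hN.le
  obtain ⟨m, hm, hmδ, hmT⟩ := hwindow δ N hδ hδ1.le hqN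
  have hT := LeTCC.one_le_logb_add_sqrt hp hp1 hδ hδ1.le hqN
  set T := Real.logb (1 / p) (q * N) + √(1 / δ)
  have hL : m * LeTCC.gapMax β ≤ 4 * A * B * (T / N) :=
    calc m * LeTCC.gapMax β ≤ A * T * (4 * B / N) :=
          mul_le_mul hmT (LeTCC.gapMax_le_div hB.le hN2 hβ hβΩ hgap) (LeTCC.gapMax_pos β).le
            (by positivity)
      _ = 4 * A * B * (T / N) := by ring
  have hL1 : 3 * (4 * A * B * (T / N)) < 1 := by
    rw [lt_div_iff₀' (by positivity)] at hsmall
    linarith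
  have hprob : ENNReal.ofReal (1 - δ) ≤
      P {s | LeTCC.HitsWindows (LeTCC.nonStragglers straggler s) m} :=
    (ENNReal.ofReal_le_ofReal (by linarith)).trans
      (LeTCC.ofReal_one_sub_le_measure_hitsWindows hind hp.le hP hm)
  refine hprob.trans (measure_mono fun s (hs : LeTCC.HitsWindows _ m) t ht => ?_)
  have hspline := hudec _ (hs.nonempty hβ hL (by linarith))
  refine (hspline.sq_sub_le_of_hitsWindows hh hlam hs hβ hβΩ hL hL1 ht).trans
    (mul_le_mul_of_nonneg_right ?_ (LeTCC.roughness_nonneg h))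
  rw [mul_pow, div_pow]
  linarith [LeTCC.natCast_mul_le_div_cube hlam4 hT]

theorem theorem1 (p q B : ℝ) (hpq : p = 1 - q) (hp : 0 < p) (hq : 0 < q) (hB : 0 < B) :
    ∃ C : ℝ, 0 < C ∧ ∀ δ : ℝ, 0 < δ → δ < 1 → ∃ n₀ : ℕ, ∀ N : ℕ, n₀ < N →
      -- the computing function
      ∀ (f : ℝ → ℝ) (ν : NNReal) (η : ℝ), LipschitzWith ν f →
        Differentiable ℝ f → Differentiable ℝ (deriv f) → 0 < η →
        (∀ z, |deriv (deriv f) z| ≤ η) →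
      -- the data, the encoder mapping points, and the encoder
      ∀ (K : ℕ) (x α : Fin K → ℝ), 0 < K → StrictMono α → (∀ k, α k ∈ LeTCC.domain) →
      ∀ uenc : ℝ → ℝ, LeTCC.MemH2 uenc →
      -- the decoder mapping points
      ∀ β : Fin N → ℝ, StrictMono β → (∀ n, β n ∈ LeTCC.domain) →
        LeTCC.gapMax β / LeTCC.gapMin β ≤ B →
      -- the decoder, for every nonempty set of non-stragglers
      ∀ lam : ℝ, 0 ≤ lam → lam ≤ 1 / (N : ℝ) ^ 4 →
      ∀ udec : Finset (Fin N) → ℝ → ℝ,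
        (∀ F : Finset (Fin N), F.Nonempty →
          LeTCC.IsSmoothingSpline F β (fun n => f (uenc (β n))) lam (udec F)) →
      -- the random stragglers
      ∀ (S : Type*) [MeasurableSpace S] (P : Measure S) [IsProbabilityMeasure P]
        (straggler : Fin N → Set S), (∀ n, MeasurableSet (straggler n)) →
        iIndepSet straggler P → (∀ n, P (straggler n) = ENNReal.ofReal p) →
      ENNReal.ofReal (1 - δ) ≤ P {s |
        LeTCC.avgError f α x (udec (LeTCC.nonStragglers straggler s)) ≤
            C * ((Real.logb (1 / p) (q * N) + Real.sqrt (1 / δ)) ^ 3 / (N : ℝ) ^ 3) *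
                LeTCC.roughness (f ∘ uenc) +
              2 / (K : ℝ) * ∑ k, (f (uenc (α k)) - f (x k)) ^ 2 ∧
        LeTCC.avgError f α x (udec (LeTCC.nonStragglers straggler s)) ≤
            C * ((Real.logb (1 / p) (q * N) + Real.sqrt (1 / δ)) ^ 3 / (N : ℝ) ^ 3) *
                LeTCC.roughness (f ∘ uenc) +
              2 * (ν : ℝ) ^ 2 / (K : ℝ) * ∑ k, (uenc (α k) - x k) ^ 2} := by
  obtain ⟨C, hC, hmain⟩ := theorem1_general p q B hpq hp hq hB
  refine ⟨2 * C, by positivity, fun δ hδ hδ1 => (hmain δ hδ hδ1).imp fun n₀ hn₀ N hN f ν η hf hfd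
    hfdd hη hf'' K x α hK _ hα uenc huenc β hβ hβΩ hgap lam hlam hlam4 udec hudec S _ P _ straggler
    _ hind hP => ?_⟩
  have hf' : LipschitzWith ⟨η, hη.le⟩ (deriv f) := lipschitzWith_of_nnnorm_deriv_le hfdd hf''
  refine (hn₀ N hN (f ∘ uenc) (huenc.comp hfd hf') β hβ hβΩ hgap lam hlam hlam4 udec hudec S P
    straggler hind fun n => (hP n).le).trans (measure_mono fun s hs => ?_)
  have hE := fun k => hs (α k) (hα k)
  rw [mul_assoc 2 C, mul_assoc 2]
  exact ⟨LeTCC.avgError_le hK hE, LeTCC.avgError_le_of_lipschitzWith hK hf hE⟩
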